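/- **Setting.** Let $\mathcal A$ be a finite set of $\alpha\ge 3$ alternatives and $G=(V,E)$ a simple, undirected, connected graph with $n$ nodes. A profile $\mathcal P=(\succ_v)_{v\in V}$ assigns to every node $v$ a strict linear order $\succ_v$ on $\mathcal A$. In each round of the Synchronous Preference Diffusion (SPD) model, every node $v$, independently of the others and of the past, chooses two distinct alternatives $a,b$ uniformly at random; if $a,b$ are adjacent in $\succ_v$ and more than half of the neighbours of $v$ disagree with $v$ on the relative order of $a$ and $b$, then $v$ swaps $a,b$ in $\succ_v$, and otherwise $\succ_v$ is unchanged; all nodes update simultaneously. A profile is fixed if no round can change it. An order $\succ$ wins if the process reaches a fixed profile in which all nodes have the order $\succ$; an alternative wins if it is in the first position for all nodes in the fixed profile that is reached. Let $n_{ab}^{\mathcal P}$ be the number of nodes that prefer $a$ over $b$ in $\mathcal P$. The order $\succ$ is $\epsilon$-Condorcet in $\mathcal P$ if $n_{ab}^{\mathcal P}>n_{ba}^{\mathcal P}+\epsilon n$ for all $a,b\in\mathcal A$ with $a\succ b$. Let $\lambda(G)=\max_{2\le i\le n}|\lambda_i|$, where $\lambda_1\ge\dots\ge\lambda_n$ are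 the eigenvalues of the normalized adjacency matrix $D^{-1/2}AD^{-1/2}$ of $G$ (here $A$ is the adjacency matrix and $D$ the diagonal matrix of the degrees), and $\lambda(G)=0$ if $n=1$. A placement chooses a position from $1$ to $\alpha$ on each node. It is a solution (in the SPD model on $G$) if every alternative that occupies the chosen positions in the initial profile wins, regardless of how the other alternatives are positioned and of the random choices, i.e. it is in the first position for all nodes in every fixed profile that the process can reach. Its cost is $\sum_{v}(\alpha-\text{position chosen at }v)$, and $\mathcal{MC}(G)$ is the minimum cost of a solution. **Theorem.** For every $\alpha\ge3$ and every $\epsilon>0$ there is a constant $\beta=\beta(\alpha,\epsilon)>0$ such that the following hold. 1. There are a constant $C>0$ and a function $\eta:\mathbb N\to\mathbb R$ with $\eta(n)\to0$ as $n\to\infty$, both depending only on $\alpha$ and $\epsilon$, such that for all $n$ and $d$, every connected $d$-regular graph $G$ on $n$ nodes with $\lambda(G)\le\beta$, every initial profile $\mathcal P_0$ and every order $\succ$ that is $\epsilon$-Condorcet in $\mathcal P_0$: in the SPD model on $G$ started from $\mathcal P_0$, with probability at least $1-\eta(n)$ the order $\succ$ wins within $C\log n$ rounds. 2. For all $n$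 and $d$ and every connected $d$-regular graph $G$ on $n$ nodes with $\lambda(G)\le\beta$, $\mathcal{MC}(G)\ge\left(\tfrac12-\epsilon\right)n(\alpha-1)$. -/

import Mathlib

open Filter Topology

/-- A strict linear order on the alternatives `A`, given by its position map: `σ a` is the
position of `a`, counted from `0` (so the most preferred alternative has position `0`). -/
abbrev PrefOrder (A : Type*) [Fintype A] := A ≃ Fin (Fintype.card A)

/-- A profile assigns a strict linear order on the alternatives to every node. -/
abbrev Profile (V A : Type*) [Fintype A] := V → PrefOrder A

/-- `a` is preferred over `b` in the order `σ`. -/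
abbrev Prefers {A : Type*} [Fintype A] (σ : PrefOrder A) (a b : A) : Prop := σ a < σ b

/-- `a` and `b` appear next to each other in `σ`: no alternative lies between them. -/
def AdjacentIn {A : Type*} [Fintype A] (σ : PrefOrder A) (a b : A) : Prop :=
  ¬ ∃ c, (Prefers σ a c ∧ Prefers σ c b) ∨ (Prefers σ b c ∧ Prefers σ c a)

/-- A choice of two distinct alternatives. (Drawing an ordered pair uniformly at random amounts
to drawing an unordered pair uniformly at random, as the update below is symmetric in the two.) -/
abbrev AltPair (A : Type*) := {p : A × A // p.1 ≠ p.2}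

instance AltPair.instNonempty (A : Type*) [Nontrivial A] : Nonempty (AltPair A) :=
  let ⟨a, b, h⟩ := exists_pair_ne A
  ⟨⟨(a, b), h⟩⟩

section Model

variable {V A : Type*} [Fintype V] [Fintype A] [DecidableEq A]

/-- The neighbours of `v` that disagree with `v` on the relative order of `a` and `b`. -/
def disagreeing (G : SimpleGraph V) [DecidableRel G.Adj] (P : Profile V A) (v : V) (a b : A) :
    Finset V :=
  (G.neighborFinset v).filter fun u => ¬ (Prefers (P u) a b ↔ Prefers (P v) a b)

open Classical in
/-- The new order of `v` after it has chosen the pair `p`: the two alternatives are swapped if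
they are adjacent in the order of `v` and more than half of the neighbours of `v` disagree with
their relative order. -/
noncomputable def nodeUpdate (G : SimpleGraph V) [DecidableRel G.Adj] (P : Profile V A)
    (v : V) (p : AltPair A) : PrefOrder A :=
  if AdjacentIn (P v) p.1.1 p.1.2 ∧
      G.degree v < 2 * (disagreeing G P v p.1.1 p.1.2).card then
    (Equiv.swap p.1.1 p.1.2).trans (P v)
  else P v

/-- One synchronous round, in which node `v` has chosen the pair `c v`. -/
noncomputable def spdRound (G : SimpleGraph V) [DecidableRel G.Adj] (P : Profile V A)
    (c : V → AltPair A) : Profile V A :=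
  fun v => nodeUpdate G P v (c v)

/-- One random synchronous round: all nodes choose their pairs independently and uniformly. -/
noncomputable def spdStep [DecidableEq V] [Nontrivial A] (G : SimpleGraph V) [DecidableRel G.Adj]
    (P : Profile V A) : PMF (Profile V A) :=
  (PMF.uniformOfFintype (V → AltPair A)).map (spdRound G P)

/-- The law of the profile after `t` rounds of the synchronous process started from `P₀`. -/
noncomputable def spdLaw [DecidableEq V] [Nontrivial A] (G : SimpleGraph V) [DecidableRel G.Adj]
    (P₀ : Profile V A) : ℕ → PMF (Profile V A)
  | 0 => PMF.pure P₀
  | t + 1 => (spdLaw G P₀ t).bind (spdStep G)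

/-- A profile is fixed if no round can change it. -/
def IsFixed (G : SimpleGraph V) [DecidableRel G.Adj] (P : Profile V A) : Prop :=
  ∀ c : V → AltPair A, spdRound G P c = P

/-- The probability that within `t` rounds the process has reached its final profile and the order
`σ` has won. (A fixed profile never changes again, so it suffices to look at round `t`.) -/
noncomputable def probOrderWinsWithin [DecidableEq V] [Nontrivial A] (G : SimpleGraph V)
    [DecidableRel G.Adj] (P₀ : Profile V A) (σ : PrefOrder A) (t : ℕ) : ℝ :=
  ((spdLaw G P₀ t).toOuterMeasure {P | IsFixed G P ∧ ∀ v, P v = σ}).toReal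

/-- The number of nodes that prefer `a` over `b`. -/
def prefCount (P : Profile V A) (a b : A) : ℕ :=
  (Finset.univ.filter fun v => Prefers (P v) a b).card

/-- The order `σ` is `ε`-Condorcet in the profile `P`. -/
def IsCondorcetOrder (ε : ℝ) (P : Profile V A) (σ : PrefOrder A) : Prop :=
  ∀ a b : A, Prefers σ a b →
    (prefCount P b a : ℝ) + ε * (Fintype.card V : ℝ) < (prefCount P a b : ℝ)

/-- `Q` can be reached from `P` by finitely many rounds, for suitable choices of the nodes. -/
def Reachable (G : SimpleGraph V) [DecidableRel G.Adj] (P Q : Profile V A) : Prop :=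
  Relation.ReflTransGen (fun P' Q' => ∃ c : V → AltPair A, Q' = spdRound G P' c) P Q

/-- The placement `s` (a position, counted from `0`, for every node) is a solution: if an
alternative `a` occupies these positions in the initial profile, then whatever the rest of the
initial profile and the choices during the process are, `a` is in the first position for all nodes
in the final profile. -/
def IsSolution (G : SimpleGraph V) [DecidableRel G.Adj]
    (s : V → Fin (Fintype.card A)) : Prop :=
  ∀ (a : A) (P₀ : Profile V A), (∀ v, P₀ v a = s v) →
    ∀ Q : Profile V A, Reachable G P₀ Q → IsFixed G Q → ∀ v, (Q v a : ℕ) = 0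

/-- The cost of a placement: the number of alternatives minus the position (counted from `1`),
summed over all nodes. -/
def placementCost (s : V → Fin (Fintype.card A)) : ℕ :=
  ∑ v, (Fintype.card A - ((s v : ℕ) + 1))

variable (A) in
/-- The minimum cost of a solution in the synchronous model on `G`. -/
noncomputable def minCost (G : SimpleGraph V) [DecidableRel G.Adj] : ℕ :=
  sInf {k | ∃ s : V → Fin (Fintype.card A), IsSolution (A := A) G s ∧ placementCost (A := A) s = k}

end Model

section Expansion

variable {V : Type*} [Fintype V] [DecidableEq V]

/-- The normalized adjacency matrix `D^(-1/2) A D^(-1/2)`. -/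
noncomputable def normalizedAdj (G : SimpleGraph V) [DecidableRel G.Adj] : Matrix V V ℝ :=
  Matrix.diagonal (fun v => (Real.sqrt (G.degree v))⁻¹) * G.adjMatrix ℝ *
    Matrix.diagonal (fun v => (Real.sqrt (G.degree v))⁻¹)

theorem normalizedAdj_isHermitian (G : SimpleGraph V) [DecidableRel G.Adj] :
    (normalizedAdj G).IsHermitian := by
  have h : (G.adjMatrix ℝ).IsHermitian := by
    ext i j
    simp [SimpleGraph.adj_comm]
  have hd : (Matrix.diagonal (fun v => (Real.sqrt (G.degree v))⁻¹)).conjTranspose =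
      Matrix.diagonal (fun v => (Real.sqrt (G.degree v))⁻¹) := by
    simp
  unfold normalizedAdj Matrix.IsHermitian
  rw [Matrix.conjTranspose_mul, Matrix.conjTranspose_mul, hd, h.eq, Matrix.mul_assoc]

/-- The second-largest absolute eigenvalue of the normalized adjacency matrix: the largest
absolute value among all its eigenvalues `λ₁ ≥ λ₂ ≥ ⋯ ≥ λₙ` (with multiplicity) other than `λ₁`.
The sequence `eigenvalues₀` is decreasing and starts with the index `0`. -/
noncomputable def expansionLambda (G : SimpleGraph V) [DecidableRel G.Adj] : ℝ :=
  ⨆ i : {i : Fin (Fintype.card V) // 1 ≤ (i : ℕ)},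
    |(normalizedAdj_isHermitian G).eigenvalues₀ i.1|

end Expansion

/-! On a regular graph the normalized adjacency matrix averages over neighbours. If a set `X` has
density at most `1/2 - δ`, its centred indicator averages to at least `δ` at every node with half
its neighbours in `X`. A small `λ` therefore leaves few such nodes, at most `(β/δ)² |X|`
(`card_weakMajority_le`). Both claims rest on this.

Confinement: a set of density at most `1/2 - 2δ` lies in a set of density at most `1/2 - δ` that is
closed under strict majorities. An adjacent swap affects only its own pair, so the supporters of `a`
over `b` never leave such a set (`card_supporters_le_of_reachable`), whatever the random choices.

Cost: the cost of a placement of `a` is the sum over `b` of the number of nodes preferring `a` to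
`b`. If it is too low, some `b` confines `a` to a minority for ever. Some fixed profile is
nevertheless reachable, by raising an energy one node at a time (`exists_reachable_isFixed`), and
`a` is not on top everywhere in it.

Convergence: the potential is the total number of inversions relative to `σ`. Confinement makes the
`card_weakMajority_le` bound available at all times, so nodes that could gain inversions are few
compared with the potential. Every other unsorted node has an adjacent inversion that its neighbours
want repaired. The expected potential thus decays geometrically (`sum_totalInversions_spdRound_le`),
and Markov's inequality after order `log n` rounds finishes. -/

/-! ### Spectral contraction on regular graphs. -/

section Spectral

variable {V : Type*} [Fintype V] [DecidableEq V]

theorem normalizedAdj_mulVec_apply {G : SimpleGraph V} [DecidableRel G.Adj] {d : ℕ}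
    (hd : G.IsRegularOfDegree d) (f : V → ℝ) (v : V) :
    (normalizedAdj G).mulVec f v = (∑ u ∈ G.neighborFinset v, f u) / d := by
  have h : (Real.sqrt d)⁻¹ * (Real.sqrt d)⁻¹ = (d : ℝ)⁻¹ := by
    rw [← mul_inv, Real.mul_self_sqrt (Nat.cast_nonneg d)]
  have hdeg : (fun v => (Real.sqrt (G.degree v))⁻¹) = fun _ : V => (Real.sqrt d)⁻¹ := by
    funext w
    rw [hd w]
  rw [normalizedAdj, hdeg, ← Matrix.mulVec_mulVec, ← Matrix.mulVec_mulVec, Matrix.mulVec_diagonal,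
    SimpleGraph.adjMatrix_mulVec_apply]
  simp only [Matrix.mulVec_diagonal]
  rw [← Finset.mul_sum, ← mul_assoc, h, div_eq_inv_mul]

/-- On vectors orthogonal to the constants, the normalized adjacency matrix contracts by
`expansionLambda G`. -/
theorem normSq_normalizedAdj_mulVec_le {G : SimpleGraph V} [DecidableRel G.Adj] {d : ℕ}
    (hd : G.IsRegularOfDegree d) (hpos : 0 < d) {β : ℝ} (hG : expansionLambda G ≤ β) (hβ : β < 1)
    (f : V → ℝ) (hf : ∑ v, f v = 0) :
    ∑ v, ((normalizedAdj G).mulVec f v) ^ 2 ≤ β ^ 2 * ∑ v, f v ^ 2 := by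
  set M := normalizedAdj G with hMdef
  have hM := normalizedAdj_isHermitian G
  set b := hM.eigenvectorBasis with hb
  set μ := hM.eigenvalues with hμ
  have hT : M.transpose = M := by simpa [Matrix.IsHermitian] using hM
  have parseval : ∀ g : V → ℝ, ∑ i, ((b i).ofLp ⬝ᵥ g) ^ 2 = ∑ v, g v ^ 2 := by
    intro g
    have h := b.sum_sq_norm_inner_right (WithLp.toLp 2 g)
    rw [EuclideanSpace.norm_sq_eq] at h
    simpa [EuclideanSpace.inner_eq_star_dotProduct, dotProduct_comm] using h
  have eig : ∀ (i : V) (g : V → ℝ), (b i).ofLp ⬝ᵥ M.mulVec g = μ i * ((b i).ofLp ⬝ᵥ g) := by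
    intro i g
    rw [Matrix.dotProduct_mulVec, ← Matrix.mulVec_transpose, hT, hM.mulVec_eigenvectorBasis,
      smul_dotProduct, smul_eq_mul]
  rcases isEmpty_or_nonempty V with hV | hV
  · simp
  have hcard : 0 < Fintype.card V := Fintype.card_pos
  -- The enumeration by which `eigenvalues` is obtained from `eigenvalues₀`; hence `o` carries the
  -- largest eigenvalue, the only one that `expansionLambda` omits.
  set e : Fin (Fintype.card V) ≃ V := Fintype.equivOfCardEq (Fintype.card_fin _) with he
  set o : V := e ⟨0, hcard⟩ with ho
  have small : ∀ i, i ≠ o → |μ i| ≤ β := by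
    intro i hi
    refine le_trans ?_ hG
    have hne : (e.symm i : ℕ) ≠ 0 := by
      intro h0
      apply hi
      rw [ho, ← e.apply_symm_apply i]
      congr 1
      exact Fin.ext h0
    exact le_ciSup (f := fun i : {i : Fin (Fintype.card V) // 1 ≤ (i : ℕ)} =>
      |hM.eigenvalues₀ i.1|) (Set.finite_range _).bddAbove ⟨e.symm i, Nat.one_le_iff_ne_zero.2 hne⟩
  have hone : M.mulVec (fun _ => 1) = fun _ => (1 : ℝ) := by
    funext v
    rw [hMdef, normalizedAdj_mulVec_apply hd]
    have : (d : ℝ) ≠ 0 := by positivity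
    simp [hd v, this]
  -- The constant vector has eigenvalue `1`, all eigenvalues away from `o` are below `1`. So it is a
  -- multiple of `b o`, and `f`, being orthogonal to it, is orthogonal to `b o`.
  have orth : ∀ i, i ≠ o → (b i).ofLp ⬝ᵥ (fun _ => (1 : ℝ)) = 0 := by
    intro i hi
    have h := eig i (fun _ => 1)
    rw [hone] at h
    have h1 : μ i < 1 := (le_abs_self _).trans_lt ((small i hi).trans_lt hβ)
    have h2 : (1 - μ i) * ((b i).ofLp ⬝ᵥ (fun _ => (1 : ℝ))) = 0 := by linarith
    rcases mul_eq_zero.1 h2 with h3 | h3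
    · linarith
    · exact h3
  have hbo : (b o).ofLp ⬝ᵥ f = 0 := by
    have hs := b.sum_inner_mul_inner (WithLp.toLp 2 fun _ => (1 : ℝ)) (WithLp.toLp 2 f)
    have hs' : ∑ i, ((b i).ofLp ⬝ᵥ (fun _ => (1 : ℝ))) * ((b i).ofLp ⬝ᵥ f) = 0 := by
      have hz : (f ⬝ᵥ fun _ => (1 : ℝ)) = 0 := by simpa [dotProduct] using hf
      simpa [EuclideanSpace.inner_eq_star_dotProduct, dotProduct_comm, hz] using hs
    rw [Finset.sum_eq_single o (fun i _ hi => by rw [orth i hi, zero_mul]) (by simp)] at hs'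
    refine (mul_eq_zero.1 hs').resolve_left fun h0 => ?_
    have hp := parseval (fun _ => 1)
    rw [Finset.sum_eq_zero] at hp
    · simp only [one_pow, Finset.sum_const, Finset.card_univ, nsmul_eq_mul, mul_one] at hp
      exact absurd hp.symm (by positivity)
    · intro i _
      by_cases hi : i = o
      · rw [hi, h0]; norm_num
      · rw [orth i hi]; norm_num
  rw [← parseval f, ← parseval (M.mulVec f), Finset.mul_sum]
  refine Finset.sum_le_sum fun i _ => ?_
  rw [eig, mul_pow]
  by_cases hi : i = o
  · rw [hi, hbo]; simp
  · exact mul_le_mul_of_nonneg_right (sq_le_sq.2 ((small i hi).trans (le_abs_self β)))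
      (sq_nonneg _)

end Spectral

/-! ### Neighbourhood majorities on expanders. -/

section Majority

variable {V : Type*} [Fintype V] [DecidableEq V]

/-- The nodes having at least half of their neighbours in `X`. -/
def weakMajority (G : SimpleGraph V) [DecidableRel G.Adj] (X : Finset V) : Finset V :=
  Finset.univ.filter fun v => G.degree v ≤ 2 * (G.neighborFinset v ∩ X).card

/-- The nodes having more than half of their neighbours in `X`. -/
def strictMajority (G : SimpleGraph V) [DecidableRel G.Adj] (X : Finset V) : Finset V :=
  Finset.univ.filter fun v => G.degree v < 2 * (G.neighborFinset v ∩ X).card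

theorem strictMajority_subset_weakMajority (G : SimpleGraph V) [DecidableRel G.Adj]
    (X : Finset V) : strictMajority G X ⊆ weakMajority G X := by
  intro v hv
  simp only [strictMajority, weakMajority, Finset.mem_filter] at hv ⊢
  exact ⟨hv.1, hv.2.le⟩

theorem strictMajority_mono (G : SimpleGraph V) [DecidableRel G.Adj] {X Y : Finset V}
    (h : X ⊆ Y) : strictMajority G X ⊆ strictMajority G Y := by
  intro v hv
  simp only [strictMajority, Finset.mem_filter] at hv ⊢
  refine ⟨hv.1, hv.2.trans_le ?_⟩
  gcongr

/-- A Chebyshev argument: the neighbourhood average of the centred indicator of `X` is at least `1/2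
- x ≥ δ` on the weak majority, while its square sum is at most `β² |X|` by contraction. -/
theorem card_weakMajority_le {G : SimpleGraph V} [DecidableRel G.Adj] {d : ℕ}
    (hd : G.IsRegularOfDegree d) (hpos : 0 < d) {β : ℝ} (hG : expansionLambda G ≤ β) (hβ : β < 1)
    {δ : ℝ} (hδ : 0 < δ) (X : Finset V) (hX : (X.card : ℝ) ≤ (1 / 2 - δ) * Fintype.card V) :
    ((weakMajority G X).card : ℝ) * δ ^ 2 ≤ β ^ 2 * X.card := by
  rcases isEmpty_or_nonempty V with hV | hV
  · simp [Finset.eq_empty_of_isEmpty]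
  have hn : (0 : ℝ) < Fintype.card V := by exact_mod_cast Fintype.card_pos
  set x : ℝ := (X.card : ℝ) / Fintype.card V with hx
  have hxn : x * Fintype.card V = X.card := div_mul_cancel₀ _ hn.ne'
  have hx2 : x ≤ 1 / 2 - δ := (div_le_iff₀ hn).2 hX
  have hx0 : 0 ≤ x := by positivity
  set f : V → ℝ := fun v => (if v ∈ X then 1 else 0) - x with hfdef
  have hf : ∑ v, f v = 0 := by
    simp [hfdef, Finset.sum_sub_distrib, mul_comm, ← hxn]
  have hf2 : ∑ v, f v ^ 2 ≤ X.card := by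
    have h1 : ∀ v, f v ^ 2 = (if v ∈ X then 1 else 0) - x * (if v ∈ X then 1 else 0) - x * f v := by
      intro v
      simp only [hfdef]
      split_ifs <;> ring
    have h2 : ∑ v, f v ^ 2 = X.card - x * X.card := by
      simp_rw [h1]
      rw [Finset.sum_sub_distrib, Finset.sum_sub_distrib, ← Finset.mul_sum, ← Finset.mul_sum, hf]
      simp
    rw [h2]
    have : 0 ≤ x * (X.card : ℝ) := by positivity
    linarith
  have hd0 : (0 : ℝ) < d := by exact_mod_cast hpos
  have hlow : ∀ v ∈ weakMajority G X, δ ^ 2 ≤ ((normalizedAdj G).mulVec f v) ^ 2 := by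
    intro v hv
    rw [normalizedAdj_mulVec_apply hd]
    have hv' : (d : ℝ) ≤ 2 * ((G.neighborFinset v ∩ X).card : ℝ) := by
      have := (Finset.mem_filter.1 hv).2
      rw [hd v] at this
      exact_mod_cast this
    have hs : ∑ u ∈ G.neighborFinset v, f u = ((G.neighborFinset v ∩ X).card : ℝ) - d * x := by
      simp [hfdef, Finset.sum_sub_distrib, hd v]
    have : δ ≤ (∑ u ∈ G.neighborFinset v, f u) / d := by
      rw [hs, le_div_iff₀ hd0]
      nlinarith
    exact pow_le_pow_left₀ hδ.le this 2
  calc ((weakMajority G X).card : ℝ) * δ ^ 2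
      = ∑ v ∈ weakMajority G X, δ ^ 2 := by simp
    _ ≤ ∑ v ∈ weakMajority G X, ((normalizedAdj G).mulVec f v) ^ 2 := Finset.sum_le_sum hlow
    _ ≤ ∑ v, ((normalizedAdj G).mulVec f v) ^ 2 :=
        Finset.sum_le_sum_of_subset_of_nonneg (Finset.subset_univ _) fun _ _ _ => sq_nonneg _
    _ ≤ β ^ 2 * ∑ v, f v ^ 2 := normSq_normalizedAdj_mulVec_le hd hpos hG hβ f hf
    _ ≤ β ^ 2 * X.card := by gcongr

/-- Any set of less than half of the nodes can be enlarged slightly to a set that is closed under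
strict majorities. -/
theorem exists_superset_strictMajority_closed {G : SimpleGraph V} [DecidableRel G.Adj] {d : ℕ}
    (hd : G.IsRegularOfDegree d) {β : ℝ} (hG : expansionLambda G ≤ β) (hβ : β < 1)
    {δ : ℝ} (hδ : 0 < δ) (hβδ : β ^ 2 ≤ δ ^ 3) (S : Finset V)
    (hS : (S.card : ℝ) ≤ (1 / 2 - 2 * δ) * Fintype.card V) :
    ∃ X : Finset V, S ⊆ X ∧ strictMajority G X ⊆ X ∧
      (X.card : ℝ) ≤ (1 / 2 - δ) * Fintype.card V := by
  have hn : (0 : ℝ) ≤ Fintype.card V := Nat.cast_nonneg _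
  -- Requiring `X \ S` to lie in the strict majority of `X` bounds all growth beyond `S` at once, by
  -- a single set of size at most `δ n`. A maximal member can then absorb its own strict majority.
  let 𝒳 : Finset (Finset V) := Finset.univ.filter fun X =>
    S ⊆ X ∧ X \ S ⊆ strictMajority G X ∧ (X.card : ℝ) ≤ (1 / 2 - δ) * Fintype.card V
  have hS𝒳 : S ∈ 𝒳 := by
    simp only [𝒳, Finset.mem_filter, Finset.mem_univ, true_and, Finset.Subset.refl,
      Finset.sdiff_self, Finset.empty_subset]
    nlinarith
  obtain ⟨X, hX⟩ := Finset.exists_maximal ⟨S, hS𝒳⟩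
  obtain ⟨-, hSX, hXS, hXc⟩ := Finset.mem_filter.1 hX.1
  refine ⟨X, hSX, ?_, hXc⟩
  have hgrow : X ∪ strictMajority G X ∈ 𝒳 := by
    have hsub : (X ∪ strictMajority G X) \ S ⊆ strictMajority G X := by
      intro v hv
      rw [Finset.mem_sdiff, Finset.mem_union] at hv
      rcases hv.1 with h | h
      · exact hXS (Finset.mem_sdiff.2 ⟨h, hv.2⟩)
      · exact h
    refine Finset.mem_filter.2 ⟨Finset.mem_univ _, hSX.trans Finset.subset_union_left,
      hsub.trans (strictMajority_mono G Finset.subset_union_left), ?_⟩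
    have h1 : (X ∪ strictMajority G X).card ≤ S.card + (strictMajority G X).card := by
      calc (X ∪ strictMajority G X).card
          ≤ (S ∪ strictMajority G X).card := Finset.card_le_card fun v hv => by
            by_cases h : v ∈ S
            · exact Finset.mem_union_left _ h
            · exact Finset.mem_union_right _ (hsub (Finset.mem_sdiff.2 ⟨hv, h⟩))
        _ ≤ _ := Finset.card_union_le _ _
    have h2 : ((strictMajority G X).card : ℝ) ≤ δ * Fintype.card V := by
      -- Degree `0` is needed for the one-node graph.
      rcases Nat.eq_zero_or_pos d with h0 | hpos
      · have : strictMajority G X = ∅ := by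
          refine Finset.filter_eq_empty_iff.2 fun v _ => ?_
          have hv := hd v
          rw [h0, ← SimpleGraph.card_neighborFinset_eq_degree, Finset.card_eq_zero] at hv
          simp [hv]
        rw [this, Finset.card_empty, Nat.cast_zero]
        positivity
      · have h3 := card_weakMajority_le hd hpos hG hβ hδ X hXc
        have h4 : ((strictMajority G X).card : ℝ) ≤ (weakMajority G X).card := by
          exact_mod_cast Finset.card_le_card (strictMajority_subset_weakMajority G X)
        have h5 : (X.card : ℝ) ≤ Fintype.card V := by exact_mod_cast Finset.card_le_univ X
        have h6 : β ^ 2 * X.card ≤ δ ^ 3 * Fintype.card V := by gcongr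
        refine h4.trans (le_of_mul_le_mul_right ?_ (pow_pos hδ 2))
        calc _ ≤ _ := h3.trans h6
          _ = _ := by ring
    have h1' : ((X ∪ strictMajority G X).card : ℝ) ≤ S.card + (strictMajority G X).card := by
      exact_mod_cast h1
    nlinarith
  exact Finset.subset_union_right.trans (hX.2 hgrow Finset.subset_union_left)

end Majority

/-! ### Adjacent swaps and inversions of linear orders. -/

section Orders

variable {A : Type*} [Fintype A]

theorem not_prefers_iff (τ : PrefOrder A) {a b : A} (h : a ≠ b) :
    ¬ Prefers τ a b ↔ Prefers τ b a := by
  rw [not_lt]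
  exact ⟨fun h' => lt_of_le_of_ne h' fun e => h (τ.injective e).symm, le_of_lt⟩

/-- Supplies an idle choice, so that a synchronous round can be made to update one node only. This
is where three alternatives are needed. -/
theorem exists_not_adjacentIn (hA : 2 < Fintype.card A) (τ : PrefOrder A) :
    ∃ p : AltPair A, ¬ AdjacentIn τ p.1.1 p.1.2 := by
  refine ⟨⟨(τ.symm ⟨0, by omega⟩, τ.symm ⟨2, hA⟩), ?_⟩, ?_⟩
  · simp [Fin.ext_iff]
  · refine not_not.2 ⟨τ.symm ⟨1, by omega⟩, Or.inl ?_⟩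
    simp [Prefers]

variable [DecidableEq A]

theorem prefers_swap_trans_self (τ : PrefOrder A) (x y : A) :
    Prefers ((Equiv.swap x y).trans τ) x y ↔ Prefers τ y x := by
  simp [Prefers]

/-- Swapping two adjacent alternatives does not affect the relative order of other pairs. -/
theorem prefers_swap_trans_of_ne {τ : PrefOrder A} {x y a b : A} (hxy : AdjacentIn τ x y)
    (h1 : ¬ (a = x ∧ b = y)) (h2 : ¬ (a = y ∧ b = x)) :
    Prefers ((Equiv.swap x y).trans τ) a b ↔ Prefers τ a b := by
  have key : ∀ c, c ≠ x → c ≠ y → ((τ x < τ c ↔ τ y < τ c) ∧ (τ c < τ x ↔ τ c < τ y)) := by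
    intro c hx hy
    have h := fun h => hxy ⟨c, h⟩
    have hx' : τ c ≠ τ x := fun e => hx (τ.injective e)
    have hy' : τ c ≠ τ y := fun e => hy (τ.injective e)
    simp only [Prefers] at h
    grind
  simp only [Prefers, Equiv.trans_apply, Equiv.swap_apply_def]
  grind

/-- The pairs that `σ` and `τ` order differently, each listed in the order of `σ`. -/
def inversions (σ τ : PrefOrder A) : Finset (AltPair A) :=
  Finset.univ.filter fun p => Prefers σ p.1.1 p.1.2 ∧ Prefers τ p.1.2 p.1.1

theorem mem_inversions {σ τ : PrefOrder A} {p : AltPair A} :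
    p ∈ inversions σ τ ↔ Prefers σ p.1.1 p.1.2 ∧ Prefers τ p.1.2 p.1.1 := by
  simp [inversions]

theorem eq_of_inversions_eq_empty {σ τ : PrefOrder A} (h : inversions σ τ = ∅) : τ = σ := by
  have key : ∀ a b, σ a < σ b → τ a < τ b := by
    intro a b hab
    have hne : a ≠ b := by rintro rfl; exact lt_irrefl _ hab
    by_contra hc
    have : (⟨(a, b), hne⟩ : AltPair A) ∈ inversions σ τ :=
      mem_inversions.2 ⟨hab, (not_prefers_iff τ hne).1 hc⟩
    rw [h] at this
    exact Finset.notMem_empty _ this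
  have hmono : StrictMono fun i => τ (σ.symm i) := by
    intro i j hij
    exact key _ _ (by simpa using hij)
  have hmono' : StrictMono fun i => σ (τ.symm i) := by
    intro i j hij
    by_contra hc
    rcases lt_or_eq_of_le (not_lt.1 hc) with h' | h'
    · exact absurd (key _ _ h') (by simpa using hij.le)
    · exact hij.ne' (by simpa using h')
  -- A strictly increasing self-map of `Fin` lies above the identity; this applies both to `τ ∘ σ⁻¹`
  -- and to its inverse.
  ext a
  have h1 := hmono.le_apply (x := σ a)
  have h2 := hmono'.le_apply (x := τ a)
  simp only [Equiv.symm_apply_apply] at h1 h2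
  exact congrArg Fin.val (le_antisymm h2 h1)

/-- Take an inversion at minimal distance in `τ`: an alternative in between would form a closer
inversion with one of its two ends. -/
theorem exists_adjacentIn_mem_inversions {σ τ : PrefOrder A} (h : (inversions σ τ).Nonempty) :
    ∃ p ∈ inversions σ τ, AdjacentIn τ p.1.1 p.1.2 := by
  obtain ⟨p, hp, hmin⟩ := Finset.exists_min_image (inversions σ τ)
    (fun p => (τ p.1.1 : ℕ) - (τ p.1.2 : ℕ)) h
  refine ⟨p, hp, ?_⟩
  obtain ⟨⟨a, b⟩, hab⟩ := p
  obtain ⟨hσ, hτ⟩ := mem_inversions.1 hp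
  simp only [Prefers, Fin.lt_def] at hσ hτ
  rintro ⟨c, hc⟩
  simp only [Prefers, Fin.lt_def] at hc
  rcases hc with hc | ⟨hbc, hca⟩
  · omega
  have hcb : c ≠ b := by rintro rfl; exact lt_irrefl _ hbc
  have hac : a ≠ c := by rintro rfl; exact lt_irrefl _ hca
  by_cases hs : Prefers σ c b
  · have := hmin ⟨(c, b), hcb⟩ (mem_inversions.2 ⟨hs, hbc⟩)
    simp only at this
    omega
  · have hs' := (not_prefers_iff σ hcb).1 hs
    have := hmin ⟨(a, c), hac⟩ (mem_inversions.2 ⟨lt_trans hσ hs', hca⟩)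
    simp only at this
    omega

end Orders

/-! ### Confinement of supporters, and reachability of fixed profiles. -/

section Dynamics

variable {V A : Type*} [Fintype V] [Fintype A]

/-- The nodes that prefer `a` over `b`. -/
def supporters (P : Profile V A) (a b : A) : Finset V :=
  Finset.univ.filter fun v => Prefers (P v) a b

theorem mem_supporters {P : Profile V A} {a b : A} {v : V} :
    v ∈ supporters P a b ↔ Prefers (P v) a b := by
  simp [supporters]

theorem card_supporters_add (P : Profile V A) {a b : A} (h : a ≠ b) :
    (supporters P a b).card + (supporters P b a).card = Fintype.card V := by
  classical
  have hc : supporters P b a = (supporters P a b)ᶜ := by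
    ext v
    rw [Finset.mem_compl, mem_supporters, mem_supporters, not_prefers_iff _ h]
  rw [hc, Finset.card_add_card_compl]

variable {G : SimpleGraph V} [DecidableRel G.Adj]

theorem disagreeing_comm (P : Profile V A) (v : V) {a b : A} (h : a ≠ b) :
    disagreeing G P v a b = disagreeing G P v b a := by
  refine Finset.filter_congr fun u _ => ?_
  rw [← not_prefers_iff (P u) h, ← not_prefers_iff (P v) h]
  tauto

/-- `1` for the nodes preferring the first alternative of `p`, and `-1` for the others. -/
def pairSign (P : Profile V A) (p : AltPair A) (v : V) : ℤ :=
  if Prefers (P v) p.1.1 p.1.2 then 1 else -1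

/-- Agreeing neighbours contribute `1`, disagreeing ones `-1`; the value is negative exactly when a
strict majority disagrees. -/
theorem pairSign_mul_sum (P : Profile V A) (p : AltPair A) (v : V) :
    pairSign P p v * ∑ u ∈ G.neighborFinset v, pairSign P p u =
      G.degree v - 2 * (disagreeing G P v p.1.1 p.1.2).card := by
  have h : ∀ u, pairSign P p v * pairSign P p u =
      1 - 2 * if ¬ (Prefers (P u) p.1.1 p.1.2 ↔ Prefers (P v) p.1.1 p.1.2) then 1 else 0 := by
    intro u
    by_cases h1 : Prefers (P u) p.1.1 p.1.2 <;> by_cases h2 : Prefers (P v) p.1.1 p.1.2 <;>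
      simp [pairSign, h1, h2]
  rw [Finset.mul_sum, Finset.sum_congr rfl fun u _ => h u, Finset.sum_sub_distrib,
    ← Finset.mul_sum, Finset.sum_boole]
  simp [disagreeing]

variable [DecidableEq V]

theorem disagreeing_of_not_prefers {P : Profile V A} {v : V} {a b : A}
    (hv : ¬ Prefers (P v) a b) :
    disagreeing G P v a b = G.neighborFinset v ∩ supporters P a b := by
  ext u
  simp [disagreeing, mem_supporters, hv]

theorem card_disagreeing_add (P : Profile V A) {v : V} {a b : A} (h : a ≠ b)
    (hv : ¬ Prefers (P v) a b) :
    (disagreeing G P v a b).card + (G.neighborFinset v ∩ supporters P b a).card = G.degree v := by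
  have hc := Finset.card_filter_add_card_filter_not (s := G.neighborFinset v)
    (fun u => Prefers (P u) a b)
  have h1 : G.neighborFinset v ∩ supporters P a b =
      (G.neighborFinset v).filter fun u => Prefers (P u) a b := by
    ext u; simp [mem_supporters]
  have h2 : G.neighborFinset v ∩ supporters P b a =
      (G.neighborFinset v).filter fun u => ¬ Prefers (P u) a b := by
    ext u; simp only [Finset.mem_inter, Finset.mem_filter, mem_supporters, not_prefers_iff _ h]
  rw [disagreeing_of_not_prefers hv, h1, h2, hc, SimpleGraph.card_neighborFinset_eq_degree]

variable [DecidableEq A]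

/-- The only way to acquire a preference is to swap that very pair, which requires a strict majority
of neighbours holding it. -/
theorem prefers_nodeUpdate {P : Profile V A} {v : V} {p : AltPair A} {a b : A} (hab : a ≠ b)
    (h : Prefers (nodeUpdate G P v p) a b) :
    Prefers (P v) a b ∨
      (v ∈ strictMajority G (supporters P a b) ∧ (p.1 = (a, b) ∨ p.1 = (b, a))) := by
  by_cases hv : Prefers (P v) a b
  · exact Or.inl hv
  refine Or.inr ?_
  obtain ⟨⟨x, y⟩, hxy⟩ := p
  simp only [nodeUpdate] at h
  split_ifs at h with hc
  · have hpair : (x, y) = (a, b) ∨ (x, y) = (b, a) := by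
      by_contra hne
      rw [prefers_swap_trans_of_ne hc.1 (fun e => hne (Or.inl (by rw [e.1, e.2])))
        (fun e => hne (Or.inr (by rw [e.1, e.2])))] at h
      exact hv h
    refine ⟨?_, hpair⟩
    have hdis : disagreeing G P v x y = disagreeing G P v a b := by
      rcases hpair with e | e
      · rw [(Prod.mk.inj e).1, (Prod.mk.inj e).2]
      · rw [(Prod.mk.inj e).1, (Prod.mk.inj e).2, disagreeing_comm P v hab]
    have hc2 := hc.2
    rw [hdis, disagreeing_of_not_prefers hv] at hc2
    simp [strictMajority, hc2]
  · exact absurd h hv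

theorem supporters_spdRound_subset {P : Profile V A} {a b : A} (hab : a ≠ b)
    (c : V → AltPair A) :
    supporters (spdRound G P c) a b ⊆
      supporters P a b ∪ strictMajority G (supporters P a b) := by
  intro v hv
  rw [mem_supporters] at hv
  rw [Finset.mem_union, mem_supporters]
  exact (prefers_nodeUpdate hab hv).imp id And.left

/-- A set of nodes closed under strict majorities confines the supporters of `a` over `b`. -/
theorem supporters_subset_of_reachable {P Q : Profile V A} {a b : A} (hab : a ≠ b)
    {X : Finset V} (hX : strictMajority G X ⊆ X) (hP : supporters P a b ⊆ X)
    (h : Reachable G P Q) : supporters Q a b ⊆ X := by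
  induction h with
  | refl => exact hP
  | tail _ hstep ih =>
    obtain ⟨c, rfl⟩ := hstep
    exact (supporters_spdRound_subset hab c).trans
      (Finset.union_subset ih ((strictMajority_mono G ih).trans hX))

/-- If `b` beats `a` with a clear margin on an expander, this remains so for ever. -/
theorem card_supporters_le_of_reachable {d : ℕ} (hd : G.IsRegularOfDegree d) {β : ℝ}
    (hG : expansionLambda G ≤ β) (hβ : β < 1) {δ : ℝ} (hδ : 0 < δ) (hβδ : β ^ 2 ≤ δ ^ 3)
    {P Q : Profile V A} {a b : A} (hab : a ≠ b)
    (hP : ((supporters P a b).card : ℝ) ≤ (1 / 2 - 2 * δ) * Fintype.card V)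
    (h : Reachable G P Q) :
    ((supporters Q a b).card : ℝ) ≤ (1 / 2 - δ) * Fintype.card V := by
  obtain ⟨X, hPX, hX, hXc⟩ := exists_superset_strictMajority_closed hd hG hβ hδ hβδ _ hP
  refine le_trans ?_ hXc
  exact_mod_cast Finset.card_le_card (supporters_subset_of_reachable hab hX hPX h)

/-! ### A fixed profile can always be reached -/

/-- The number of agreeing minus the number of disagreeing adjacent nodes, for signs `s`. -/
def signEnergy (G : SimpleGraph V) [DecidableRel G.Adj] (s : V → ℤ) : ℤ :=
  s ⬝ᵥ (G.adjMatrix ℤ).mulVec s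

/-- The graph has no loops, so the flip changes the energy by exactly `-4 s v ∑ s u`. -/
theorem signEnergy_flip (s : V → ℤ) (v : V)
    (hs : s v * ∑ u ∈ G.neighborFinset v, s u < 0) :
    signEnergy G s < signEnergy G (Function.update s v (-s v)) := by
  have hup : Function.update s v (-s v) = s + Pi.single v (-2 * s v) := by
    funext u
    by_cases h : u = v
    · subst h; simp; ring
    · simp [h]
  have hsymm : s ⬝ᵥ (G.adjMatrix ℤ).mulVec (Pi.single v (-2 * s v)) =
      Pi.single v (-2 * s v) ⬝ᵥ (G.adjMatrix ℤ).mulVec s := by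
    rw [Matrix.dotProduct_mulVec, ← Matrix.mulVec_transpose, SimpleGraph.transpose_adjMatrix,
      dotProduct_comm]
  rw [signEnergy, signEnergy, hup, Matrix.mulVec_add, dotProduct_add, add_dotProduct,
    add_dotProduct, hsymm]
  simp only [single_dotProduct, SimpleGraph.adjMatrix_mulVec_apply]
  have h0 : ∑ u ∈ G.neighborFinset v, (Pi.single v (-2 * s v) : V → ℤ) u = 0 := by
    refine Finset.sum_eq_zero fun u hu => ?_
    rw [SimpleGraph.mem_neighborFinset] at hu
    exact Pi.single_eq_of_ne hu.ne' _
  rw [h0]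
  linarith

/-- The total energy of a profile. -/
def profileEnergy (G : SimpleGraph V) [DecidableRel G.Adj] (P : Profile V A) : ℤ :=
  ∑ p : AltPair A, signEnergy G (pairSign P p)

/-- Only `p` and its reversal change sign at `v`, and the energy of both rises. -/
theorem profileEnergy_lt_update_swap {P : Profile V A} {v : V} {p : AltPair A}
    (hadj : AdjacentIn (P v) p.1.1 p.1.2)
    (hmaj : G.degree v < 2 * (disagreeing G P v p.1.1 p.1.2).card) :
    profileEnergy G P <
      profileEnergy G (Function.update P v ((Equiv.swap p.1.1 p.1.2).trans (P v))) := by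
  set P' := Function.update P v ((Equiv.swap p.1.1 p.1.2).trans (P v)) with hP'
  have same : ∀ q : AltPair A, ¬ (q.1.1 = p.1.1 ∧ q.1.2 = p.1.2) →
      ¬ (q.1.1 = p.1.2 ∧ q.1.2 = p.1.1) → pairSign P' q = pairSign P q := by
    intro q h1 h2
    funext u
    by_cases h : u = v
    · subst h
      simp only [pairSign, hP', Function.update_self, prefers_swap_trans_of_ne hadj h1 h2]
    · simp [pairSign, hP', h]
  have flip : ∀ q : AltPair A, (q.1.1 = p.1.1 ∧ q.1.2 = p.1.2) ∨
      (q.1.1 = p.1.2 ∧ q.1.2 = p.1.1) →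
      signEnergy G (pairSign P q) < signEnergy G (pairSign P' q) := by
    intro q hq
    have hu : pairSign P' q = Function.update (pairSign P q) v (-pairSign P q v) := by
      funext u
      by_cases h : u = v
      · subst h
        have : Prefers ((Equiv.swap p.1.1 p.1.2).trans (P u)) q.1.1 q.1.2 ↔
            ¬ Prefers (P u) q.1.1 q.1.2 := by
          rw [not_prefers_iff _ q.2]
          rcases hq with ⟨h1, h2⟩ | ⟨h1, h2⟩
          · rw [h1, h2, prefers_swap_trans_self]
          · rw [h1, h2, Equiv.swap_comm, prefers_swap_trans_self]
        simp only [pairSign, hP', Function.update_self, this]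
        split_ifs <;> simp_all
      · simp [pairSign, hP', h]
    rw [hu]
    apply signEnergy_flip
    rw [pairSign_mul_sum]
    have hdis : disagreeing G P v q.1.1 q.1.2 = disagreeing G P v p.1.1 p.1.2 := by
      rcases hq with ⟨h1, h2⟩ | ⟨h1, h2⟩
      · rw [h1, h2]
      · rw [h1, h2, disagreeing_comm P v p.2]
    rw [hdis]
    omega
  refine Finset.sum_lt_sum (fun q _ => ?_) ⟨p, Finset.mem_univ _, flip p (Or.inl ⟨rfl, rfl⟩)⟩
  by_cases hq : (q.1.1 = p.1.1 ∧ q.1.2 = p.1.2) ∨ (q.1.1 = p.1.2 ∧ q.1.2 = p.1.1)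
  · exact (flip q hq).le
  · rw [same q (fun h => hq (Or.inl h)) (fun h => hq (Or.inr h))]

/-- A reachable profile of maximal energy is fixed: otherwise a willing node could swap while all
others stay idle. Moving one node at a time matters, since the energy argument covers single flips
only. -/
theorem exists_reachable_isFixed (hA : 2 < Fintype.card A) (P : Profile V A) :
    ∃ Q, Reachable G P Q ∧ IsFixed G Q := by
  obtain ⟨Q, hQ⟩ := Set.Finite.exists_maximalFor (profileEnergy G) {Q | Reachable G P Q}
    (Set.toFinite _) ⟨P, Relation.ReflTransGen.refl⟩
  refine ⟨Q, hQ.1, fun c => ?_⟩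
  by_contra hne
  obtain ⟨v, hv⟩ := Function.ne_iff.1 hne
  have hcond : AdjacentIn (Q v) (c v).1.1 (c v).1.2 ∧
      G.degree v < 2 * (disagreeing G Q v (c v).1.1 (c v).1.2).card := by
    by_contra h
    exact hv (if_neg h)
  choose w hw using fun u => exists_not_adjacentIn hA (Q u)
  have hround : spdRound G Q (Function.update w v (c v)) =
      Function.update Q v ((Equiv.swap (c v).1.1 (c v).1.2).trans (Q v)) := by
    funext u
    by_cases h : u = v
    · subst h
      simp [spdRound, nodeUpdate, hcond]
    · simp [spdRound, nodeUpdate, h, hw]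
  have hreach : Reachable G P
      (Function.update Q v ((Equiv.swap (c v).1.1 (c v).1.2).trans (Q v))) :=
    Relation.ReflTransGen.tail hQ.1 ⟨_, hround.symm⟩
  have hlt := profileEnergy_lt_update_swap hcond.1 hcond.2
  exact absurd (hQ.2 hreach hlt.le) (not_le.2 hlt)

end Dynamics

/-! ### Double counting of preferences and inversions. -/

section Counting

variable {V A : Type*} [Fintype V] [Fintype A] [DecidableEq A]

theorem sum_card_supporters (P : Profile V A) (a : A) :
    ∑ b ∈ Finset.univ.erase a, (supporters P a b).card =
      placementCost (A := A) fun v => P v a := by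
  have h0 : (supporters P a a).card = 0 := by simp [supporters, Prefers]
  rw [Finset.sum_erase (f := fun b => (supporters P a b).card) _ h0, placementCost]
  simp only [supporters, Finset.card_filter]
  rw [Finset.sum_comm]
  refine Finset.sum_congr rfl fun v _ => ?_
  rw [Fintype.sum_equiv (P v) _ (fun i => if P v a < i then 1 else 0) fun b => rfl,
    ← Finset.card_filter, Finset.filter_lt_eq_Ioi, Fin.card_Ioi, Nat.sub_sub, add_comm]

theorem card_inversions_le (σ τ : PrefOrder A) :
    (inversions σ τ).card ≤ Fintype.card (AltPair A) := Finset.card_le_univ _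

/-- The total number of inversions of a profile with respect to `σ`. -/
def totalInversions (σ : PrefOrder A) (P : Profile V A) : ℕ :=
  ∑ v, (inversions σ (P v)).card

theorem totalInversions_eq_sum_supporters (σ : PrefOrder A) (P : Profile V A) :
    totalInversions σ P = ∑ p : AltPair A with Prefers σ p.1.1 p.1.2,
      (supporters P p.1.2 p.1.1).card := by
  simp only [totalInversions, inversions, supporters, Finset.card_filter]
  rw [Finset.sum_comm, Finset.sum_filter]
  refine Finset.sum_congr rfl fun p _ => ?_
  split_ifs with h <;> simp [h]

theorem totalInversions_le (σ : PrefOrder A) (P : Profile V A) :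
    totalInversions σ P ≤ Fintype.card V * Fintype.card (AltPair A) := by
  rw [totalInversions, ← smul_eq_mul, ← Finset.card_univ]
  exact Finset.sum_le_card_nsmul _ _ _ fun v _ => card_inversions_le _ _

theorem eq_of_totalInversions_eq_zero {σ : PrefOrder A} {P : Profile V A}
    (h : totalInversions σ P = 0) (v : V) : P v = σ :=
  eq_of_inversions_eq_empty
    (Finset.card_eq_zero.1 (Finset.sum_eq_zero_iff.1 h v (Finset.mem_univ v)))

theorem isFixed_of_forall_eq {G : SimpleGraph V} [DecidableRel G.Adj] {σ : PrefOrder A}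
    {P : Profile V A} (h : ∀ v, P v = σ) :
    IsFixed G P := by
  intro c
  funext v
  refine if_neg fun hc => ?_
  simp [disagreeing, h] at hc

end Counting

/-! ### The lower bound on the cost of solutions. -/

section Solutions

variable {V A : Type*} [Fintype V] [DecidableEq V] [Fintype A] [DecidableEq A]
variable {G : SimpleGraph V} [DecidableRel G.Adj]

/-- Nobody prefers another alternative at the start, and the empty set is closed under strict
majorities. This makes the infimum in `minCost` range over a nonempty set. -/
theorem isSolution_zero (s : V → Fin (Fintype.card A)) (hs : ∀ v, (s v : ℕ) = 0) :
    IsSolution (A := A) G s := by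
  intro a P₀ hP Q hQ _ v
  by_contra hne
  have hpos : 0 < Fintype.card A := (Nat.zero_le _).trans_lt (Q v a).isLt
  set b := (Q v).symm ⟨0, hpos⟩ with hb
  have hQb : Q v b = ⟨0, hpos⟩ := by simp [hb]
  have hba : b ≠ a := by
    rintro h
    rw [h] at hQb
    exact hne (by rw [hQb])
  have hX : strictMajority G (∅ : Finset V) ⊆ ∅ := by
    intro u hu
    simp [strictMajority] at hu
  have h0 : supporters P₀ b a ⊆ ∅ := by
    intro u hu
    rw [mem_supporters, Prefers, hP, Fin.lt_def, hs] at hu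
    omega
  have hv : v ∈ supporters Q b a := by
    rw [mem_supporters, Prefers, hQb, Fin.lt_def]
    exact Nat.pos_of_ne_zero hne
  exact Finset.notMem_empty _ (supporters_subset_of_reachable hba hX h0 hQ hv)

theorem le_placementCost_of_isSolution [Nonempty V] (hA : 2 < Fintype.card A) {d : ℕ}
    (hd : G.IsRegularOfDegree d) {β : ℝ} (hG : expansionLambda G ≤ β) (hβ : β < 1) {δ : ℝ}
    (hδ : 0 < δ) (hβδ : β ^ 2 ≤ δ ^ 3) {s : V → Fin (Fintype.card A)}
    (hs : IsSolution (A := A) G s) :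
    (1 / 2 - 2 * δ) * (Fintype.card V : ℝ) * ((Fintype.card A : ℝ) - 1) ≤
      (placementCost (A := A) s : ℝ) := by
  by_contra! hlt
  have hn : (0 : ℝ) < Fintype.card V := by exact_mod_cast Fintype.card_pos
  have : Nonempty A := Fintype.card_pos_iff.1 (by omega)
  obtain ⟨a⟩ := this
  set e := Fintype.equivFin A
  set P₀ : Profile V A := fun v => e.trans (Equiv.swap (e a) (s v)) with hP₀
  have hPa : ∀ v, P₀ v a = s v := fun v => by simp [hP₀]
  have hsum := sum_card_supporters P₀ a
  simp only [hPa] at hsum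
  have hcard : ((Finset.univ.erase a).card : ℝ) = (Fintype.card A : ℝ) - 1 := by
    rw [Finset.card_erase_of_mem (Finset.mem_univ a), Finset.card_univ, Nat.cast_sub (by omega)]
    simp
  -- Pigeonhole over the `α - 1` rivals of `a`.
  obtain ⟨b, hb, hle⟩ : ∃ b ∈ Finset.univ.erase a,
      ((supporters P₀ a b).card : ℝ) ≤ (1 / 2 - 2 * δ) * Fintype.card V := by
    refine Finset.exists_le_of_sum_le (Finset.card_pos.1 ?_) ?_
    · rw [Finset.card_erase_of_mem (Finset.mem_univ a), Finset.card_univ]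
      omega
    · rw [Finset.sum_const, nsmul_eq_mul, hcard, ← Nat.cast_sum, hsum]
      linarith
  -- Without a reachable fixed profile, being a solution would be vacuous.
  obtain ⟨Q, hQ, hfix⟩ := exists_reachable_isFixed (G := G) hA P₀
  have hab : a ≠ b := (Finset.ne_of_mem_erase hb).symm
  have h1 := card_supporters_le_of_reachable hd hG hβ hδ hβδ hab hle hQ
  have htop := hs a P₀ hPa Q hQ hfix
  have h2 : supporters Q a b = Finset.univ := by
    refine Finset.eq_univ_of_forall fun v => mem_supporters.2 ?_
    refine Fin.lt_def.2 ?_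
    rw [htop v]
    refine Nat.pos_of_ne_zero fun h0 => hab ((Q v).injective (Fin.ext ?_))
    rw [htop v, h0]
  rw [h2, Finset.card_univ] at h1
  nlinarith

theorem le_minCost [Nonempty V] (hA : 2 < Fintype.card A) {d : ℕ}
    (hd : G.IsRegularOfDegree d) {β : ℝ} (hG : expansionLambda G ≤ β) (hβ : β < 1) {δ : ℝ}
    (hδ : 0 < δ) (hβδ : β ^ 2 ≤ δ ^ 3) :
    (1 / 2 - 2 * δ) * (Fintype.card V : ℝ) * ((Fintype.card A : ℝ) - 1) ≤ (minCost A G : ℝ) := by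
  have hne : {k | ∃ s : V → Fin (Fintype.card A), IsSolution (A := A) G s ∧
      placementCost (A := A) s = k}.Nonempty :=
    ⟨_, fun _ => ⟨0, by omega⟩, isSolution_zero _ fun _ => rfl, rfl⟩
  obtain ⟨s, hs, hcost⟩ := Nat.sInf_mem hne
  rw [minCost, ← hcost]
  exact le_placementCost_of_isSolution hA hd hG hβ hδ hβδ hs

end Solutions

/-! ### Expected decrease of the number of inversions. -/

section Drift

variable {V A : Type*} [Fintype V] [DecidableEq V] [Fintype A] [DecidableEq A]
variable {G : SimpleGraph V} [DecidableRel G.Adj]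

/-- The nodes at which, for some pair, at least half of the neighbours disagree with `σ`. -/
def misledNodes (G : SimpleGraph V) [DecidableRel G.Adj] (σ : PrefOrder A) (P : Profile V A) :
    Finset V :=
  (Finset.univ.filter fun p : AltPair A => Prefers σ p.1.1 p.1.2).biUnion fun p =>
    weakMajority G (supporters P p.1.2 p.1.1)

theorem inversions_nodeUpdate_subset (σ : PrefOrder A) (P : Profile V A) (v : V)
    (p : AltPair A) :
    inversions σ (nodeUpdate G P v p) ⊆
      inversions σ (P v) ∪ {p, ⟨p.1.swap, fun h => p.2 h.symm⟩} := by
  intro q hq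
  obtain ⟨h1, h2⟩ := mem_inversions.1 hq
  rw [Finset.mem_union, mem_inversions]
  rcases prefers_nodeUpdate q.2.symm h2 with h | ⟨-, h | h⟩
  · exact Or.inl ⟨h1, h⟩
  · right
    simp [Subtype.ext_iff, Prod.ext_iff, h]
  · right
    simp [Subtype.ext_iff, Prod.ext_iff, h]

theorem inversions_nodeUpdate_subset_of_notMem {σ : PrefOrder A} {P : Profile V A} {v : V}
    (hv : v ∉ misledNodes G σ P) (p : AltPair A) :
    inversions σ (nodeUpdate G P v p) ⊆ inversions σ (P v) := by
  intro q hq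
  obtain ⟨h1, h2⟩ := mem_inversions.1 hq
  refine mem_inversions.2 ⟨h1, ?_⟩
  rcases prefers_nodeUpdate q.2.symm h2 with h | ⟨h, -⟩
  · exact h
  · exact absurd (Finset.mem_biUnion.2 ⟨q, Finset.mem_filter.2 ⟨Finset.mem_univ _, h1⟩,
      strictMajority_subset_weakMajority _ _ h⟩) hv

/-- Some inversion is adjacent. Fewer than half of the neighbours share it, so a strict majority
disagrees and the swap is carried out. This is why misled nodes are defined by weak majorities. -/
theorem exists_inversions_nodeUpdate_lt {σ : PrefOrder A} {P : Profile V A} {v : V}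
    (hv : v ∉ misledNodes G σ P) (hne : (inversions σ (P v)).Nonempty) :
    ∃ p, (inversions σ (nodeUpdate G P v p)).card + 1 ≤ (inversions σ (P v)).card := by
  obtain ⟨p, hp, hadj⟩ := exists_adjacentIn_mem_inversions hne
  refine ⟨p, Finset.card_lt_card ⟨inversions_nodeUpdate_subset_of_notMem hv p, fun hsub => ?_⟩⟩
  have hp' := mem_inversions.1 hp
  have hnp := (not_prefers_iff (P v) p.2).2 hp'.2
  have hw : v ∉ weakMajority G (supporters P p.1.2 p.1.1) := fun h =>
    hv (Finset.mem_biUnion.2 ⟨p, Finset.mem_filter.2 ⟨Finset.mem_univ _, hp'.1⟩, h⟩)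
  have hdeg := card_disagreeing_add (G := G) P p.2 hnp
  have hcond : AdjacentIn (P v) p.1.1 p.1.2 ∧
      G.degree v < 2 * (disagreeing G P v p.1.1 p.1.2).card := by
    refine ⟨hadj, ?_⟩
    simp only [weakMajority, Finset.mem_filter, Finset.mem_univ, true_and, not_le] at hw
    omega
  have h2 := (mem_inversions.1 (hsub hp)).2
  rw [nodeUpdate, if_pos hcond, ← not_prefers_iff _ p.2, prefers_swap_trans_self] at h2
  exact h2 hp'.2

theorem card_choices_eq (v : V) (p : AltPair A) :
    (Finset.univ.filter fun c : V → AltPair A => c v = p).card * Fintype.card (AltPair A) =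
      Fintype.card (V → AltPair A) := by
  have h := Fintype.card_filter_piFinset_const_eq_of_mem (Finset.univ : Finset (AltPair A)) v
    (Finset.mem_univ p)
  rw [Fintype.piFinset_univ] at h
  have hV : 0 < Fintype.card V := Fintype.card_pos_iff.2 ⟨v⟩
  rw [h, Finset.card_univ, Fintype.card_fun, ← pow_succ, Nat.sub_add_cancel hV]

/-- At a node that is not misled, the expected number of inversions decreases. -/
theorem sum_card_inversions_nodeUpdate_le {σ : PrefOrder A} {P : Profile V A} {v : V}
    (hv : v ∉ misledNodes G σ P) :
    ∑ c : V → AltPair A, ((inversions σ (nodeUpdate G P v (c v))).card : ℝ) ≤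
      Fintype.card (V → AltPair A) *
        ((1 - 1 / (Fintype.card (AltPair A) : ℝ) ^ 2) * (inversions σ (P v)).card) := by
  set N : ℝ := (Fintype.card (AltPair A) : ℝ) with hN
  set M : ℝ := (Fintype.card (V → AltPair A) : ℝ) with hM
  have hM0 : 0 ≤ M := Nat.cast_nonneg _
  rcases (inversions σ (P v)).eq_empty_or_nonempty with h0 | hne
  · have : ∀ c : V → AltPair A, inversions σ (nodeUpdate G P v (c v)) = ∅ := fun c =>
      Finset.subset_empty.1 (h0 ▸ inversions_nodeUpdate_subset_of_notMem hv (c v))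
    simp [this, h0]
  obtain ⟨p, hp⟩ := exists_inversions_nodeUpdate_lt hv hne
  set I : ℝ := ((inversions σ (P v)).card : ℝ) with hI
  have hNpos : 0 < N := by
    rw [hN]
    exact_mod_cast Fintype.card_pos_iff.2 ⟨p⟩
  have hIN : I ≤ N := by rw [hI, hN]; exact_mod_cast card_inversions_le σ (P v)
  have hterm : ∀ c : V → AltPair A,
      ((inversions σ (nodeUpdate G P v (c v))).card : ℝ) ≤ I - if c v = p then 1 else 0 := by
    intro c
    split_ifs with h
    · rw [h, le_sub_iff_add_le, hI]
      exact_mod_cast hp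
    · rw [sub_zero, hI]
      exact_mod_cast Finset.card_le_card (inversions_nodeUpdate_subset_of_notMem hv (c v))
  refine (Finset.sum_le_sum fun c _ => hterm c).trans ?_
  rw [Finset.sum_sub_distrib, Finset.sum_const, Finset.sum_boole, Finset.card_univ, nsmul_eq_mul,
    ← hM]
  have hc : ((Finset.univ.filter fun c : V → AltPair A => c v = p).card : ℝ) = M / N := by
    rw [eq_div_iff hNpos.ne', hN, hM]
    exact_mod_cast card_choices_eq v p
  rw [hc]
  -- The helpful pair is drawn with probability `1 / N`; as `I ≤ N`, losing one inversion then
  -- amounts to at least the fraction `1 / N²` of `I`.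
  have h1 : I / N ^ 2 ≤ 1 / N := by
    rw [div_le_div_iff₀ (by positivity) hNpos]
    nlinarith
  have h2 : M * (I / N ^ 2) ≤ M * (1 / N) := mul_le_mul_of_nonneg_left h1 hM0
  calc M * I - M / N = M * I - M * (1 / N) := by ring
    _ ≤ M * I - M * (I / N ^ 2) := by linarith
    _ = _ := by ring

theorem sum_card_inversions_nodeUpdate_le_add [Nontrivial A] (σ : PrefOrder A) (P : Profile V A)
    (v : V) :
    ∑ c : V → AltPair A, ((inversions σ (nodeUpdate G P v (c v))).card : ℝ) ≤
      Fintype.card (V → AltPair A) *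
        ((1 - 1 / (Fintype.card (AltPair A) : ℝ) ^ 2) * (inversions σ (P v)).card + 3) := by
  set N : ℝ := (Fintype.card (AltPair A) : ℝ) with hN
  set I : ℝ := ((inversions σ (P v)).card : ℝ) with hI
  have hN1 : 1 ≤ N := by
    rw [hN]
    exact_mod_cast Fintype.card_pos
  have hIN : I ≤ N := by rw [hI, hN]; exact_mod_cast card_inversions_le σ (P v)
  have h1 : I / N ^ 2 ≤ 1 := by
    rw [div_le_one (by positivity)]
    nlinarith
  have hterm : ∀ c : V → AltPair A,
      ((inversions σ (nodeUpdate G P v (c v))).card : ℝ) ≤ I + 2 := by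
    intro c
    have h := (Finset.card_le_card (inversions_nodeUpdate_subset (G := G) σ P v (c v))).trans
      ((Finset.card_union_le _ _).trans (Nat.add_le_add_left Finset.card_le_two _))
    rw [hI]
    exact_mod_cast h
  -- The `3` is `2` for the possible new inversions plus `1` for the contraction term `I / N²`,
  -- which is not earned here.
  calc _ ≤ ∑ c : V → AltPair A, (I + 2) := Finset.sum_le_sum fun c _ => hterm c
    _ = Fintype.card (V → AltPair A) * (I + 2) := by
      rw [Finset.sum_const, Finset.card_univ, nsmul_eq_mul]
    _ ≤ _ := by
      refine mul_le_mul_of_nonneg_left ?_ (Nat.cast_nonneg _)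
      have : (1 - 1 / N ^ 2) * I = I - I / N ^ 2 := by ring
      linarith

/-- While few nodes are misled, the expected total number of inversions decays geometrically. -/
theorem sum_totalInversions_spdRound_le [Nontrivial A] (σ : PrefOrder A) (P : Profile V A)
    (h : ∀ p : AltPair A, Prefers σ p.1.1 p.1.2 →
      ((weakMajority G (supporters P p.1.2 p.1.1)).card : ℝ) ≤
        1 / (6 * (Fintype.card (AltPair A) : ℝ) ^ 2) * (supporters P p.1.2 p.1.1).card) :
    ∑ c : V → AltPair A, (totalInversions σ (spdRound G P c) : ℝ) ≤
      Fintype.card (V → AltPair A) *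
        ((1 - 1 / (2 * (Fintype.card (AltPair A) : ℝ) ^ 2)) * totalInversions σ P) := by
  set N : ℝ := (Fintype.card (AltPair A) : ℝ) with hN
  set M : ℝ := (Fintype.card (V → AltPair A) : ℝ) with hM
  have hmis : ((misledNodes G σ P).card : ℝ) ≤ 1 / (6 * N ^ 2) * totalInversions σ P := by
    rw [totalInversions_eq_sum_supporters, Nat.cast_sum, Finset.mul_sum]
    refine (Nat.cast_le.2 Finset.card_biUnion_le).trans ?_
    rw [Nat.cast_sum]
    exact Finset.sum_le_sum fun p hp => h p (Finset.mem_filter.1 hp).2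
  have hnode : ∀ v, ∑ c : V → AltPair A, ((inversions σ (nodeUpdate G P v (c v))).card : ℝ) ≤
      M * ((1 - 1 / N ^ 2) * (inversions σ (P v)).card +
        3 * if v ∈ misledNodes G σ P then 1 else 0) := by
    intro v
    split_ifs with hv
    · rw [mul_one]
      exact sum_card_inversions_nodeUpdate_le_add σ P v
    · rw [mul_zero, add_zero]
      exact sum_card_inversions_nodeUpdate_le hv
  simp only [totalInversions, spdRound, Nat.cast_sum] at hmis ⊢
  rw [Finset.sum_comm]
  refine (Finset.sum_le_sum fun v _ => hnode v).trans ?_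
  rw [← Finset.mul_sum, Finset.sum_add_distrib, ← Finset.mul_sum, ← Finset.mul_sum,
    Finset.sum_boole, Finset.filter_mem_eq_inter, Finset.univ_inter]
  refine mul_le_mul_of_nonneg_left ?_ (Nat.cast_nonneg _)
  set S : ℝ := ∑ v, ((inversions σ (P v)).card : ℝ)
  -- The misled nodes add at most `3 · S / (6 N²)`, half of the gain `S / N²`.
  have h1 : 1 / (6 * N ^ 2) * S = 1 / 6 * (S / N ^ 2) := by ring
  have h2 : (1 - 1 / N ^ 2) * S = S - S / N ^ 2 := by ring
  have h3 : (1 - 1 / (2 * N ^ 2)) * S = S - 1 / 2 * (S / N ^ 2) := by ring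
  rw [h1] at hmis
  rw [h2, h3]
  linarith

end Drift

/-! ### Expectations under a `PMF`. -/

section Expectation

variable {α β : Type*}

/-- The expectation of a function with values in `ℝ≥0∞`. -/
noncomputable def PMF.expect (μ : PMF α) (g : α → ENNReal) : ENNReal := ∑' x, μ x * g x

theorem PMF.expect_pure (a : α) (g : α → ENNReal) : (PMF.pure a).expect g = g a := by
  rw [PMF.expect, tsum_eq_single a]
  · simp
  · intro b hb
    simp [PMF.pure_apply, hb]

theorem PMF.expect_bind (μ : PMF α) (κ : α → PMF β) (g : β → ENNReal) :
    (μ.bind κ).expect g = μ.expect fun a => (κ a).expect g := by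
  simp only [PMF.expect, PMF.bind_apply, ← ENNReal.tsum_mul_right, ← ENNReal.tsum_mul_left]
  rw [ENNReal.tsum_comm]
  simp only [mul_assoc]

theorem PMF.expect_map (μ : PMF α) (f : α → β) (g : β → ENNReal) :
    (μ.map f).expect g = μ.expect fun a => g (f a) := by
  rw [← PMF.bind_pure_comp, PMF.expect_bind]
  simp only [Function.comp_apply, PMF.expect_pure]

/-- Markov's inequality for the complement of a set off which `g` is at least `1`. -/
theorem PMF.one_le_toOuterMeasure_add_expect (μ : PMF α) (g : α → ENNReal) (s : Set α)
    (h : ∀ x ∉ s, 1 ≤ g x) : 1 ≤ μ.toOuterMeasure s + μ.expect g := by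
  rw [← μ.tsum_coe, PMF.toOuterMeasure_apply, PMF.expect, ← ENNReal.tsum_add]
  refine ENNReal.tsum_le_tsum fun x => ?_
  by_cases hx : x ∈ s
  · simp [hx]
  · rw [Set.indicator_of_notMem hx, zero_add]
    exact le_mul_of_one_le_right' (h x hx)

end Expectation

/-! ### From drift to a winning probability. -/

section Convergence

variable {V A : Type*} [Fintype V] [DecidableEq V] [Fintype A] [DecidableEq A] [Nontrivial A]
variable {G : SimpleGraph V} [DecidableRel G.Adj]

theorem reachable_of_mem_support_spdLaw {P₀ : Profile V A} {t : ℕ} {P : Profile V A}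
    (h : P ∈ (spdLaw G P₀ t).support) : Reachable G P₀ P := by
  induction t generalizing P with
  | zero =>
    rw [spdLaw, PMF.support_pure, Set.mem_singleton_iff] at h
    rw [h]
    exact Relation.ReflTransGen.refl
  | succ t ih =>
    rw [spdLaw, PMF.mem_support_bind_iff] at h
    obtain ⟨Q, hQ, hP⟩ := h
    rw [spdStep, PMF.support_map] at hP
    obtain ⟨c, -, rfl⟩ := hP
    exact Relation.ReflTransGen.tail (ih hQ) ⟨c, rfl⟩

theorem expect_spdStep_le {P : Profile V A} {f : Profile V A → ℕ} {r : ℝ}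
    (h : ∑ c : V → AltPair A, (f (spdRound G P c) : ℝ) ≤
      Fintype.card (V → AltPair A) * (r * f P)) :
    (spdStep G P).expect (fun Q => (f Q : ENNReal)) ≤ ENNReal.ofReal r * f P := by
  have hM : (0 : ℝ) < Fintype.card (V → AltPair A) := by exact_mod_cast Fintype.card_pos
  rw [spdStep, PMF.expect_map, PMF.expect, tsum_fintype]
  simp only [PMF.uniformOfFintype_apply]
  rw [← Finset.mul_sum, ← Nat.cast_sum, ← ENNReal.ofReal_natCast, ← ENNReal.ofReal_natCast,
    ← ENNReal.ofReal_natCast, ← ENNReal.ofReal_inv_of_pos hM, ← ENNReal.ofReal_mul (by positivity),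
    ← ENNReal.ofReal_mul' (by positivity)]
  refine ENNReal.ofReal_le_ofReal ?_
  rw [Nat.cast_sum, inv_mul_le_iff₀ hM]
  exact h

theorem expect_spdLaw_le {P₀ : Profile V A} {f : Profile V A → ℕ} {r : ℝ}
    (h : ∀ P, Reachable G P₀ P → ∑ c : V → AltPair A, (f (spdRound G P c) : ℝ) ≤
      Fintype.card (V → AltPair A) * (r * f P)) (t : ℕ) :
    (spdLaw G P₀ t).expect (fun Q => (f Q : ENNReal)) ≤ ENNReal.ofReal r ^ t * f P₀ := by
  induction t with
  | zero => rw [spdLaw, PMF.expect_pure, pow_zero, one_mul]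
  | succ t ih =>
    rw [spdLaw, PMF.expect_bind]
    calc (spdLaw G P₀ t).expect (fun P => (spdStep G P).expect fun Q => (f Q : ENNReal))
        ≤ ENNReal.ofReal r * (spdLaw G P₀ t).expect (fun Q => (f Q : ENNReal)) := by
          rw [PMF.expect, PMF.expect, ← ENNReal.tsum_mul_left]
          refine ENNReal.tsum_le_tsum fun P => ?_
          by_cases hP : P ∈ (spdLaw G P₀ t).support
          · rw [mul_left_comm]
            gcongr
            exact expect_spdStep_le (h P (reachable_of_mem_support_spdLaw hP))
          · rw [PMF.mem_support_iff, not_not] at hP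
            simp [hP]
      _ ≤ ENNReal.ofReal r * (ENNReal.ofReal r ^ t * f P₀) := by gcongr
      _ = _ := by rw [pow_succ', mul_assoc]

theorem le_probOrderWinsWithin {P₀ : Profile V A} {σ : PrefOrder A} {r : ℝ} (hr : 0 ≤ r)
    (h : ∀ P, Reachable G P₀ P → ∑ c : V → AltPair A, (totalInversions σ (spdRound G P c) : ℝ) ≤
      Fintype.card (V → AltPair A) * (r * totalInversions σ P)) (t : ℕ) :
    1 - r ^ t * totalInversions σ P₀ ≤ probOrderWinsWithin G P₀ σ t := by
  set W : Set (Profile V A) := {P | IsFixed G P ∧ ∀ v, P v = σ} with hW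
  have hmarkov := (spdLaw G P₀ t).one_le_toOuterMeasure_add_expect
    (fun Q => (totalInversions σ Q : ENNReal)) W fun P hP => by
      -- The potential is integer-valued, so it is at least `1` unless `σ` has already won.
      rw [Nat.one_le_cast, Nat.one_le_iff_ne_zero]
      intro h0
      have heq := eq_of_totalInversions_eq_zero h0
      exact hP ⟨isFixed_of_forall_eq heq, heq⟩
  have hx : 0 ≤ r ^ t * totalInversions σ P₀ := by positivity
  have hle := hmarkov.trans (add_le_add_right (expect_spdLaw_le h t) _)
  rw [← ENNReal.ofReal_pow hr, ← ENNReal.ofReal_natCast, ← ENNReal.ofReal_mul (by positivity)]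
    at hle
  have hfin : (spdLaw G P₀ t).toOuterMeasure W ≠ ⊤ := by
    refine ne_top_of_le_ne_top ENNReal.one_ne_top ?_
    rw [PMF.toOuterMeasure_apply, ← (spdLaw G P₀ t).tsum_coe]
    exact ENNReal.tsum_le_tsum fun x => Set.indicator_le_self _ _ _
  have hreal := ENNReal.toReal_mono (ENNReal.add_ne_top.2 ⟨hfin, ENNReal.ofReal_ne_top⟩) hle
  rw [ENNReal.toReal_add hfin ENNReal.ofReal_ne_top, ENNReal.toReal_ofReal hx,
    ENNReal.toReal_one] at hreal
  rw [probOrderWinsWithin]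
  linarith

/-- On an expander, a Condorcet order wins up to an exponentially small failure probability. -/
theorem le_probOrderWinsWithin_of_isCondorcetOrder {d : ℕ} (hd : G.IsRegularOfDegree d)
    (hpos : 0 < d) {β : ℝ} (hG : expansionLambda G ≤ β) (hβ : β < 1) {δ : ℝ} (hδ : 0 < δ)
    (hβδ : β ^ 2 ≤ δ ^ 3)
    (hβN : β ^ 2 ≤ δ ^ 2 * (1 / (6 * (Fintype.card (AltPair A) : ℝ) ^ 2)))
    {P₀ : Profile V A} {σ : PrefOrder A} (hσ : IsCondorcetOrder (4 * δ) P₀ σ) (t : ℕ) :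
    1 - (1 - 1 / (2 * (Fintype.card (AltPair A) : ℝ) ^ 2)) ^ t *
      (Fintype.card V * Fintype.card (AltPair A)) ≤ probOrderWinsWithin G P₀ σ t := by
  set N : ℝ := (Fintype.card (AltPair A) : ℝ) with hN
  have hN1 : 1 ≤ N := by
    rw [hN]
    exact_mod_cast Fintype.card_pos
  have hr : 0 ≤ 1 - 1 / (2 * N ^ 2) := by
    rw [sub_nonneg, div_le_one (by positivity)]
    nlinarith
  refine le_trans ?_ (le_probOrderWinsWithin hr (fun P hP => ?_) t)
  · have h : (totalInversions σ P₀ : ℝ) ≤ Fintype.card V * N := by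
      rw [hN]
      exact_mod_cast totalInversions_le σ P₀
    have := mul_le_mul_of_nonneg_left h (pow_nonneg hr t)
    linarith
  · refine sum_totalInversions_spdRound_le σ P fun p hp => ?_
    have hstart : ((supporters P₀ p.1.2 p.1.1).card : ℝ) ≤
        (1 / 2 - 2 * δ) * Fintype.card V := by
      have h1 := hσ _ _ hp
      have h2 : ((supporters P₀ p.1.1 p.1.2).card : ℝ) + (supporters P₀ p.1.2 p.1.1).card =
          Fintype.card V := by exact_mod_cast card_supporters_add P₀ p.2
      change ((supporters P₀ p.1.2 p.1.1).card : ℝ) + _ < (supporters P₀ p.1.1 p.1.2).card at h1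
      linarith
    have hX := card_supporters_le_of_reachable hd hG hβ hδ hβδ p.2.symm hstart hP
    have hweak := card_weakMajority_le hd hpos hG hβ hδ _ hX
    refine le_of_mul_le_mul_right (hweak.trans ?_) (pow_pos hδ 2)
    calc _ ≤ δ ^ 2 * (1 / (6 * N ^ 2)) * ((supporters P p.1.2 p.1.1).card : ℝ) := by gcongr
      _ = _ := by ring

end Convergence

/-! ### Choice of constants and conclusion. -/

theorem one_sub_pow_floor_log_le {κ : ℝ} (hκ0 : 0 < κ) (hκ1 : κ ≤ 1) {n : ℕ} (hn : 0 < n) :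
    (1 - κ) ^ ⌊2 / κ * Real.log n⌋₊ ≤ Real.exp 1 / (n : ℝ) ^ 2 := by
  have hn' : (0 : ℝ) < n := by exact_mod_cast hn
  set t := ⌊2 / κ * Real.log n⌋₊ with ht
  -- Rounding down loses less than one round, which costs at most the factor `e`.
  have hfloor : 2 / κ * Real.log n < t + 1 := Nat.lt_floor_add_one _
  have h1 : κ * (2 / κ * Real.log n) = 2 * Real.log n := by field_simp
  have h2 : 2 * Real.log n ≤ κ * (t + 1) := by
    rw [← h1]
    exact mul_le_mul_of_nonneg_left hfloor.le hκ0.le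
  have hexp : Real.exp (2 * Real.log n) = (n : ℝ) ^ 2 := by
    rw [two_mul, Real.exp_add, Real.exp_log hn', sq]
  calc (1 - κ) ^ t ≤ Real.exp (-κ) ^ t := by
        refine pow_le_pow_left₀ (by linarith) ?_ t
        have := Real.add_one_le_exp (-κ)
        linarith
    _ = Real.exp (-(t * κ)) := by rw [← Real.exp_nat_mul]; ring_nf
    _ ≤ Real.exp (1 - 2 * Real.log n) := Real.exp_le_exp.2 (by nlinarith)
    _ = Real.exp 1 / (n : ℝ) ^ 2 := by rw [Real.exp_sub, hexp]

theorem theorem3p5 {A : Type*} [Fintype A] [DecidableEq A] [Nontrivial A]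
    (hA : 2 < Fintype.card A) (ε : ℝ) (hε : 0 < ε) :
    ∃ β : ℝ, 0 < β ∧
      (∃ (C : ℝ) (η : ℕ → ℝ), 0 < C ∧ Tendsto η atTop (𝓝 0) ∧
        ∀ (n d : ℕ) (G : SimpleGraph (Fin n)) [DecidableRel G.Adj],
          G.Connected → G.IsRegularOfDegree d → expansionLambda G ≤ β →
          ∀ (P₀ : Profile (Fin n) A) (σ : PrefOrder A), IsCondorcetOrder ε P₀ σ →
            1 - η n ≤ probOrderWinsWithin G P₀ σ ⌊C * Real.log n⌋₊) ∧
      (∀ (n d : ℕ) (G : SimpleGraph (Fin n)) [DecidableRel G.Adj],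
          G.Connected → G.IsRegularOfDegree d → expansionLambda G ≤ β →
          (1 / 2 - ε) * (n : ℝ) * ((Fintype.card A : ℝ) - 1) ≤ (minCost A G : ℝ)) := by
  set N : ℝ := (Fintype.card (AltPair A) : ℝ) with hN
  have hN1 : 1 ≤ N := by
    rw [hN]
    exact_mod_cast Fintype.card_pos
  -- A margin of `4δn` leaves the losing side at most `(1/2 - 2δ)n` nodes; confinement spends one
  -- `δ`, `card_weakMajority_le` uses the other.
  obtain ⟨δ, rfl⟩ : ∃ δ, ε = 4 * δ := ⟨ε / 4, by ring⟩
  have hδ : 0 < δ := by linarith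
  -- With `β = √m`, the three bounds serve `β < 1`, confinement and drift respectively.
  set m : ℝ := min (1 / 4) (min (δ ^ 3) (δ ^ 2 * (1 / (6 * N ^ 2)))) with hm
  have hm0 : 0 < m := by positivity
  have hsq : Real.sqrt m ^ 2 = m := Real.sq_sqrt hm0.le
  have hβ1 : Real.sqrt m < 1 := by
    rw [Real.sqrt_lt' one_pos]
    exact (min_le_left _ _).trans_lt (by norm_num)
  have hβδ : Real.sqrt m ^ 2 ≤ δ ^ 3 := hsq.trans_le <| (min_le_right _ _).trans (min_le_left _ _)
  have hβN : Real.sqrt m ^ 2 ≤ δ ^ 2 * (1 / (6 * N ^ 2)) :=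
    hsq.trans_le <| (min_le_right _ _).trans (min_le_right _ _)
  set κ : ℝ := 1 / (2 * N ^ 2) with hκ
  have hκ0 : 0 < κ := by positivity
  have hκ1 : κ ≤ 1 := by
    rw [hκ, div_le_one (by positivity)]
    nlinarith
  -- The potential starts at no more than `n N`; `2 / κ` makes the decay `e / n²`, so failure has
  -- probability at most `e N / n`.
  refine ⟨Real.sqrt m, Real.sqrt_pos.2 hm0, ⟨2 / κ, fun n => Real.exp 1 * N / n, by positivity,
    tendsto_const_div_atTop_nhds_zero_nat _, ?_⟩, ?_⟩
  · intro n d G _ hconn hd hG P₀ σ hσ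
    have := hconn.nonempty
    have hn : 0 < n := Fin.pos_iff_nonempty.2 this
    have hn' : (0 : ℝ) < n := by exact_mod_cast hn
    rcases Nat.lt_or_ge 1 n with h1n | hn1
    · have : Nontrivial (Fin n) := Fin.nontrivial_iff_two_le.2 h1n
      have hpos : 0 < d := by
        rw [← hd ⟨0, hn⟩]
        exact hconn.preconnected.degree_pos_of_nontrivial _
      refine le_trans ?_ (le_probOrderWinsWithin_of_isCondorcetOrder hd hpos hG hβ1 hδ hβδ hβN hσ _)
      have h2 := one_sub_pow_floor_log_le hκ0 hκ1 hn
      have h3 := mul_le_mul_of_nonneg_right h2 (by positivity : 0 ≤ (n : ℝ) * N)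
      have h4 : Real.exp 1 / (n : ℝ) ^ 2 * (n * N) = Real.exp 1 * N / n := by field_simp
      rw [Fintype.card_fin]
      linarith
    -- Here the degree is `0` and no round is run, but `η 1 = e N ≥ 1` makes the bound trivial.
    · obtain rfl : n = 1 := by omega
      have h2 : 0 ≤ probOrderWinsWithin G P₀ σ ⌊2 / κ * Real.log (1 : ℕ)⌋₊ :=
        ENNReal.toReal_nonneg
      have h3 := Real.add_one_le_exp (1 : ℝ)
      refine le_trans ?_ h2
      simp only [Nat.cast_one, div_one]
      nlinarith
  · intro n d G _ hconn hd hG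
    have := hconn.nonempty
    have h := le_minCost (A := A) hA hd hG hβ1 hδ hβδ
    rw [Fintype.card_fin] at h
    refine le_trans ?_ h
    have hA1 : (0 : ℝ) ≤ (Fintype.card A : ℝ) - 1 := by
      have : (2 : ℝ) < Fintype.card A := by exact_mod_cast hA
      linarith
    gcongr
    linarith
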